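/- A Markov process is a pair $(X,\alpha)$ where $X$ is a compact Hausdorff space and $\alpha : X \to \mathcal{R}^{\le 1}(X)$ is a continuous map; here $\mathcal{R}^{\le 1}(X)$ is the set of Radon subprobability measures on $X$ with the weak-* topology, i.e. the coarsest topology that makes $\mu \mapsto \int_X f\,d\mu$ continuous for each $f \in C(X)$. A morphism from $(X,\alpha)$ to $(Y,\beta)$ is a continuous map $f : X \to Y$ such that $\beta(f(x))$ is the push-forward of $\alpha(x)$ along $f$, for all $x \in X$. A final Markov coalgebra is a final (terminal) object of the category of Markov processes and these morphisms. The formulas of Riesz modal logic are generated by $$\phi,\psi ::= 0 \mid 1 \mid r\phi \mid \phi+\psi \mid \phi\sqcup\psi \mid \phi\sqcap\psi \mid \Diamond\phi \qquad (r\in\mathbb{R}),$$ and the semantics $[\![\phi]\!]_\alpha \in C(X)$ of a formula over a Markov process $(X,\alpha)$ is defined by reading $0$, $1$, $r(\cdot)$, $+$, $\sqcup$, $\sqcap$ as the pointwise constants, scalar multiplication, sum, maximum and minimum, and by $[\![\Diamond\phi]\!]_\alpha(x) = \int_X [\![\phi]\!]_\alpha \, d\alpha(x)$. **Theorem 7.2.**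 A final Markov coalgebra $\alpha_{\mathbf{F}} : \mathbf{F} \to \mathcal{R}^{\le 1}(\mathbf{F})$ exists, and for any two points $x, y \in \mathbf{F}$ with $x \neq y$ there is a formula $\phi$ such that $[\![\phi]\!]_{\alpha_{\mathbf{F}}}(x) \neq [\![\phi]\!]_{\alpha_{\mathbf{F}}}(y)$. -/

import Mathlib

open MeasureTheory Topology

universe u v

noncomputable section

namespace RieszModal

/-- Radon subprobability measures on a (compact Hausdorff) space `X` with its Borel `σ`-algebra:
measures of total mass at most one such that the measure of each Borel set is the supremum of
the measures of its compact subsets. -/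
structure RadonSubprob (X : Type u) [TopologicalSpace X] [MeasurableSpace X] where
  toMeasure : Measure X
  mass_le_one : toMeasure Set.univ ≤ 1
  innerRegular : toMeasure.InnerRegular

namespace RadonSubprob

variable {X : Type u} [TopologicalSpace X] [MeasurableSpace X]

/-- The expectation functional of a Radon subprobability measure. -/
def expect (μ : RadonSubprob X) (f : C(X, ℝ)) : ℝ := ∫ x, f x ∂μ.toMeasure

/-- The weak-* topology: the coarsest one for which all maps `μ ↦ ∫ f dμ`, `f ∈ C(X)`, are
continuous. -/
instance : TopologicalSpace (RadonSubprob X) :=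
  ⨅ f : C(X, ℝ), TopologicalSpace.induced (fun μ : RadonSubprob X => μ.expect f) inferInstance

theorem continuous_expect (f : C(X, ℝ)) : Continuous fun μ : RadonSubprob X => μ.expect f :=
  continuous_iff_le_induced.2 (iInf_le _ f)

/-- The action on a continuous map: the push-forward measure, whose expectation functional is
`g ↦ 𝔼_μ (g ∘ f)`. -/
def map {Y : Type v} [TopologicalSpace Y] [MeasurableSpace Y] [BorelSpace X] [BorelSpace Y]
    (f : C(X, Y)) (μ : RadonSubprob X) : RadonSubprob Y where
  toMeasure := μ.toMeasure.map f
  mass_le_one := by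
    rw [Measure.map_apply f.continuous.measurable MeasurableSet.univ]
    simpa using μ.mass_le_one
  innerRegular := by
    have := μ.innerRegular
    exact Measure.InnerRegular.map_of_continuous f.continuous

end RadonSubprob

/-- A Markov process: a compact Hausdorff space `X` (with its Borel `σ`-algebra) together with a
continuous map from `X` to the Radon subprobability measures on `X`. -/
structure MarkovProcess where
  State : Type u
  [top : TopologicalSpace State]
  [compact : CompactSpace State]
  [hausdorff : T2Space State]
  [meas : MeasurableSpace State]
  [borel : BorelSpace State]
  trans : C(State, RadonSubprob State)

attribute [instance] MarkovProcess.top MarkovProcess.compact MarkovProcess.hausdorff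
  MarkovProcess.meas MarkovProcess.borel

namespace MarkovProcess

/-- `f` is a coalgebra morphism from `α` to `β`. -/
def IsHom (α : MarkovProcess.{u}) (β : MarkovProcess.{v}) (f : C(α.State, β.State)) : Prop :=
  ∀ x, RadonSubprob.map f (α.trans x) = β.trans (f x)

/-- `ω` is a final coalgebra, i.e. a terminal object of the category of Markov processes and
coalgebra morphisms. -/
def IsFinal (ω : MarkovProcess.{u}) : Prop :=
  ∀ β : MarkovProcess.{u}, ∃! f : C(β.State, ω.State), IsHom β ω f

/-- The operator `◇_α` on `C(X)`, `◇_α f (x) = ∫ f dα(x)`. -/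
def diamond (α : MarkovProcess.{u}) (f : C(α.State, ℝ)) : C(α.State, ℝ) where
  toFun x := (α.trans x).expect f
  continuous_toFun := (RadonSubprob.continuous_expect f).comp α.trans.continuous

end MarkovProcess

/-- Formulas of Riesz modal logic. -/
inductive Formula : Type where
  | zero : Formula
  | one : Formula
  | smul : ℝ → Formula → Formula
  | add : Formula → Formula → Formula
  | sup : Formula → Formula → Formula
  | inf : Formula → Formula → Formula
  | diamond : Formula → Formula

/-- The semantics of a formula over a Markov process, a continuous real-valued function on the
state space. The operations on `C(X)` on the right are pointwise. -/
def Formula.sem (α : MarkovProcess.{u}) : Formula → C(α.State, ℝ)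
  | .zero => 0
  | .one => 1
  | .smul r φ => r • φ.sem α
  | .add φ ψ => φ.sem α + ψ.sem α
  | .sup φ ψ => φ.sem α ⊔ ψ.sem α
  | .inf φ ψ => φ.sem α ⊓ ψ.sem α
  | .diamond φ => α.diamond (φ.sem α)

end RieszModal

end

/-! A state is sent to its theory, the values of all formulas at it. Each formula is bounded
uniformly over all processes, so the closure of the set of theories is a compact Hausdorff space,
small even though all processes are quantified over; `ULift` keeps it in universe `u`. By
Stone-Weierstrass the formulas are dense in its continuous functions (`denseRange_eval`). As `◇` is
linear, positive and contractive on formulas, it extends to all continuous functions (`diamondOp`),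
and Riesz-Markov-Kakutani turns the extension into transition measures. Theory maps are morphisms
into this process, unique because morphisms preserve semantics and formulas separate its points. -/

noncomputable section

namespace RieszModal

/-! ### Expectation functionals of Radon subprobability measures. -/

namespace RadonSubprob

variable {X : Type u} [TopologicalSpace X] [MeasurableSpace X]

instance (μ : RadonSubprob X) : IsFiniteMeasure μ.toMeasure :=
  ⟨μ.mass_le_one.trans_lt ENNReal.one_lt_top⟩

theorem integrable [CompactSpace X] [BorelSpace X] (μ : RadonSubprob X) (f : C(X, ℝ)) :
    Integrable f μ.toMeasure :=
  f.continuous.integrable_of_hasCompactSupport (HasCompactSupport.of_compactSpace f)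

theorem expect_add [CompactSpace X] [BorelSpace X] (μ : RadonSubprob X) (f g : C(X, ℝ)) :
    μ.expect (f + g) = μ.expect f + μ.expect g :=
  integral_add (μ.integrable f) (μ.integrable g)

theorem expect_smul (μ : RadonSubprob X) (r : ℝ) (f : C(X, ℝ)) :
    μ.expect (r • f) = r * μ.expect f :=
  integral_const_mul r _

theorem expect_zero (μ : RadonSubprob X) : μ.expect 0 = 0 := by
  simp [expect]

theorem expect_nonneg (μ : RadonSubprob X) {f : C(X, ℝ)} (hf : 0 ≤ f) : 0 ≤ μ.expect f :=
  integral_nonneg fun x => hf x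

theorem abs_expect_le (μ : RadonSubprob X) {f : C(X, ℝ)} {C : ℝ} (hC : 0 ≤ C)
    (hf : ∀ x, |f x| ≤ C) : |μ.expect f| ≤ C := by
  refine (norm_integral_le_of_norm_le_const
    (ae_of_all _ fun x => (Real.norm_eq_abs (f x)).trans_le (hf x))).trans ?_
  have : μ.toMeasure.real Set.univ ≤ 1 :=
    ENNReal.toReal_le_of_le_ofReal zero_le_one (by simpa using μ.mass_le_one)
  exact mul_le_of_le_one_right hC this

theorem continuous_expect_right [CompactSpace X] [BorelSpace X] (μ : RadonSubprob X) :
    Continuous μ.expect := by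
  have h : LipschitzWith 1 μ.expect := LipschitzWith.of_dist_le_mul fun f g => by
    have h1 : μ.expect f - μ.expect g = μ.expect (f - g) :=
      (integral_sub (μ.integrable f) (μ.integrable g)).symm
    rw [Real.dist_eq, h1, NNReal.coe_one, one_mul]
    exact μ.abs_expect_le dist_nonneg fun x => by
      simpa [Real.dist_eq] using ContinuousMap.dist_apply_le_dist (f := f) (g := g) x
  exact h.continuous

theorem expect_map {Y : Type v} [TopologicalSpace Y] [MeasurableSpace Y] [BorelSpace X]
    [BorelSpace Y] (f : C(X, Y)) (μ : RadonSubprob X) (g : C(Y, ℝ)) :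
    (map f μ).expect g = μ.expect (g.comp f) :=
  integral_map f.continuous.aemeasurable g.continuous.measurable.aestronglyMeasurable

/-- Uniqueness in Riesz representation; it reduces the morphism equations to identities between
expectations. -/
theorem ext_expect [CompactSpace X] [T2Space X] [BorelSpace X] {μ ν : RadonSubprob X}
    (h : ∀ f, μ.expect f = ν.expect f) : μ = ν := by
  have := μ.innerRegular
  have := ν.innerRegular
  have h' : μ.toMeasure = ν.toMeasure :=
    Measure.ext_of_integral_eq_on_compactlySupported fun f => h f.toContinuousMap
  cases μ
  cases ν
  cases h'
  rfl

theorem continuous_of_continuous_expect {Z : Type*} [TopologicalSpace Z] {F : Z → RadonSubprob X}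
    (h : ∀ f, Continuous fun z => (F z).expect f) : Continuous F :=
  continuous_iInf_rng.2 fun f => continuous_induced_rng.2 (h f)

/-- The Riesz-Markov-Kakutani theorem on a compact Hausdorff space, for functionals of norm at
most one. -/
theorem exists_expect_eq [CompactSpace X] [T2Space X] [BorelSpace X] (Λ : C(X, ℝ) →ₗ[ℝ] ℝ)
    (hpos : ∀ f, 0 ≤ f → 0 ≤ Λ f) (hone : Λ 1 ≤ 1) :
    ∃ μ : RadonSubprob X, ∀ f, μ.expect f = Λ f := by
  let Λ' : CompactlySupportedContinuousMap X ℝ →ₚ[ℝ] ℝ := PositiveLinearMap.mk₀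
    { toFun := fun f => Λ f.toContinuousMap
      map_add' := fun f g => Λ.map_add f.toContinuousMap g.toContinuousMap
      map_smul' := fun r f => Λ.map_smul r f.toContinuousMap }
    fun f hf => hpos f.toContinuousMap hf
  have key (f : C(X, ℝ)) : ∫ x, f x ∂(RealRMK.rieszMeasure Λ') = Λ f :=
    RealRMK.integral_rieszMeasure Λ' ⟨f, HasCompactSupport.of_compactSpace f⟩
  refine ⟨⟨RealRMK.rieszMeasure Λ', ?_, inferInstance⟩, key⟩
  have h1 : (RealRMK.rieszMeasure Λ').real Set.univ ≤ 1 := by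
    rw [← key] at hone
    simpa using hone
  rw [← ENNReal.ofReal_toReal (measure_ne_top (RealRMK.rieszMeasure Λ') Set.univ)]
  exact ENNReal.ofReal_le_one.2 h1

end RadonSubprob

/-! ### Uniform bounds and invariance of the semantics under morphisms. -/

/-- A uniform bound for the semantics of a formula over all Markov processes. -/
def Formula.bound : Formula → ℝ
  | .zero => 0
  | .one => 1
  | .smul r φ => |r| * φ.bound
  | .add φ ψ => φ.bound + ψ.bound
  | .sup φ ψ => max φ.bound ψ.bound
  | .inf φ ψ => max φ.bound ψ.bound
  | .diamond φ => φ.bound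

theorem Formula.bound_nonneg : ∀ φ : Formula, 0 ≤ φ.bound
  | .zero => le_rfl
  | .one => zero_le_one
  | .smul r φ => mul_nonneg (abs_nonneg r) φ.bound_nonneg
  | .add φ ψ => add_nonneg φ.bound_nonneg ψ.bound_nonneg
  | .sup φ _ => φ.bound_nonneg.trans (le_max_left _ _)
  | .inf φ _ => φ.bound_nonneg.trans (le_max_left _ _)
  | .diamond φ => φ.bound_nonneg

theorem Formula.abs_sem_le (α : MarkovProcess.{u}) :
    ∀ (φ : Formula) (x : α.State), |φ.sem α x| ≤ φ.bound
  | .zero, x => by simp [sem, bound]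
  | .one, x => by simp [sem, bound]
  | .smul r φ, x => by
    simpa [sem, bound, abs_mul] using mul_le_mul_of_nonneg_left (φ.abs_sem_le α x) (abs_nonneg r)
  | .add φ ψ, x => (abs_add_le _ _).trans (add_le_add (φ.abs_sem_le α x) (ψ.abs_sem_le α x))
  | .sup φ ψ, x => abs_max_le_max_abs_abs.trans
      (max_le_max (φ.abs_sem_le α x) (ψ.abs_sem_le α x))
  | .inf φ ψ, x => abs_min_le_max_abs_abs.trans
      (max_le_max (φ.abs_sem_le α x) (ψ.abs_sem_le α x))
  | .diamond φ, x => (α.trans x).abs_expect_le φ.bound_nonneg (φ.abs_sem_le α)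

/-- Coalgebra morphisms preserve the semantics of formulas. -/
theorem MarkovProcess.IsHom.sem_comp {α : MarkovProcess.{u}} {β : MarkovProcess.{v}}
    {f : C(α.State, β.State)} (hf : IsHom α β f) : ∀ φ : Formula, (φ.sem β).comp f = φ.sem α
  | .zero => rfl
  | .one => rfl
  | .smul r φ => congrArg (r • ·) (hf.sem_comp φ)
  | .add φ ψ => congrArg₂ (· + ·) (hf.sem_comp φ) (hf.sem_comp ψ)
  | .sup φ ψ => congrArg₂ (· ⊔ ·) (hf.sem_comp φ) (hf.sem_comp ψ)
  | .inf φ ψ => congrArg₂ (· ⊓ ·) (hf.sem_comp φ) (hf.sem_comp ψ)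
  | .diamond φ => by
    ext x
    change (β.trans (f x)).expect (φ.sem β) = (α.trans x).expect (φ.sem α)
    rw [← hf x, RadonSubprob.expect_map, hf.sem_comp φ]

theorem MarkovProcess.IsHom.sem_apply {α : MarkovProcess.{u}} {β : MarkovProcess.{v}}
    {f : C(α.State, β.State)} (hf : IsHom α β f) (φ : Formula) (x : α.State) :
    φ.sem β (f x) = φ.sem α x :=
  DFunLike.congr_fun (hf.sem_comp φ) x

theorem MarkovProcess.isHom_id (α : MarkovProcess.{u}) : IsHom α α (ContinuousMap.id _) :=
  fun x => RadonSubprob.ext_expect fun g => by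
    rw [RadonSubprob.expect_map]
    rfl

theorem MarkovProcess.IsHom.comp {α β γ : MarkovProcess.{u}} {f : C(α.State, β.State)}
    {g : C(β.State, γ.State)} (hg : IsHom β γ g) (hf : IsHom α β f) : IsHom α γ (g.comp f) :=
  fun x => RadonSubprob.ext_expect fun h => by
    rw [RadonSubprob.expect_map, ← ContinuousMap.comp_assoc, ← RadonSubprob.expect_map, hf x,
      ← RadonSubprob.expect_map, hg (f x)]
    rfl

/-! ### The canonical state space and the density of formulas. -/

/-- The theory of a state of a Markov process, i.e. the values of all formulas at that state. -/
def theoryAt (α : MarkovProcess.{u}) (x : α.State) : ULift.{u} Formula → ℝ :=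
  fun φ => φ.down.sem α x

/-- The theories of all states of all Markov processes. -/
def theories : Set (ULift.{u} Formula → ℝ) :=
  {v | ∃ (α : MarkovProcess.{u}) (x : α.State), theoryAt α x = v}

/-- The canonical state space, the closure of the set of theories of states. -/
def CanonicalState : Type u := closure theories.{u}

namespace CanonicalState

instance : TopologicalSpace CanonicalState.{u} :=
  inferInstanceAs (TopologicalSpace (closure theories.{u}))

instance : T2Space CanonicalState.{u} := inferInstanceAs (T2Space (closure theories.{u}))

/-- Theories lie in a product of compact intervals, compact by Tychonoff. -/
instance : CompactSpace CanonicalState.{u} := by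
  have hK : IsCompact (Set.univ.pi fun φ : ULift.{u} Formula =>
      Set.Icc (-φ.down.bound) φ.down.bound) := isCompact_univ_pi fun _ => isCompact_Icc
  have hsub : theories.{u} ⊆ Set.univ.pi fun φ : ULift.{u} Formula =>
      Set.Icc (-φ.down.bound) φ.down.bound := by
    rintro _ ⟨α, x, rfl⟩ φ -
    exact abs_le.1 (φ.down.abs_sem_le α x)
  exact isCompact_iff_compactSpace.1
    (hK.of_isClosed_subset isClosed_closure (closure_minimal hsub hK.isClosed))

instance : MeasurableSpace CanonicalState.{u} := borel _

instance : BorelSpace CanonicalState.{u} := ⟨rfl⟩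

/-- The state of the canonical space given by the theory of a state. -/
def ofState (α : MarkovProcess.{u}) (x : α.State) : CanonicalState.{u} :=
  ⟨theoryAt α x, subset_closure ⟨α, x, rfl⟩⟩

/-- The evaluation of a formula on the canonical state space. -/
def eval (φ : Formula) : C(CanonicalState.{u}, ℝ) where
  toFun v := v.1 ⟨φ⟩
  continuous_toFun := (continuous_apply _).comp continuous_subtype_val

theorem ext_eval {v w : CanonicalState.{u}} (h : ∀ φ, eval φ v = eval φ w) : v = w :=
  Subtype.ext (funext fun φ => h φ.down)

/-- The map to the canonical state space that sends a state to its theory. -/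
def ofStateMap (α : MarkovProcess.{u}) : C(α.State, CanonicalState.{u}) where
  toFun := ofState α
  continuous_toFun := Continuous.subtype_mk (continuous_pi fun φ => (φ.down.sem α).continuous) _

/-- Theories of actual states are dense, so identities and weak inequalities valid in every process
pass to the limit points. -/
theorem closed_induction {p : CanonicalState.{u} → Prop} (hp : IsClosed {v | p v})
    (h : ∀ (α : MarkovProcess.{u}) (x : α.State), p (ofState α x)) (v : CanonicalState.{u}) :
    p v := by
  have hd : DenseRange (Set.inclusion (subset_closure (s := theories.{u}))) :=
    (denseRange_inclusion_iff subset_closure).2 subset_rfl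
  refine hd.induction_on v hp ?_
  rintro ⟨_, α, x, rfl⟩
  exact h α x

theorem eq_of_ofState {f g : C(CanonicalState.{u}, ℝ)}
    (h : ∀ (α : MarkovProcess.{u}) (x : α.State), f (ofState α x) = g (ofState α x)) : f = g :=
  ContinuousMap.ext (closed_induction (isClosed_eq f.continuous g.continuous) h)

theorem eval_zero : eval.{u} .zero = 0 := eq_of_ofState fun _ _ => rfl

theorem eval_one : eval.{u} .one = 1 := eq_of_ofState fun _ _ => rfl

theorem eval_smul (r : ℝ) (φ : Formula) : eval.{u} (.smul r φ) = r • eval φ :=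
  eq_of_ofState fun _ _ => rfl

theorem eval_add (φ ψ : Formula) : eval.{u} (.add φ ψ) = eval φ + eval ψ :=
  eq_of_ofState fun _ _ => rfl

theorem eval_sup (φ ψ : Formula) : eval.{u} (.sup φ ψ) = eval φ ⊔ eval ψ :=
  eq_of_ofState fun _ _ => rfl

theorem eval_inf (φ ψ : Formula) : eval.{u} (.inf φ ψ) = eval φ ⊓ eval ψ :=
  eq_of_ofState fun _ _ => rfl

theorem eval_diamond_zero : eval.{u} (.diamond .zero) = 0 :=
  eq_of_ofState fun α x => (α.trans x).expect_zero

theorem eval_diamond_smul (r : ℝ) (φ : Formula) :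
    eval.{u} (.diamond (.smul r φ)) = r • eval (.diamond φ) :=
  eq_of_ofState fun α x => (α.trans x).expect_smul r (φ.sem α)

theorem eval_diamond_add (φ ψ : Formula) :
    eval.{u} (.diamond (.add φ ψ)) = eval (.diamond φ) + eval (.diamond ψ) :=
  eq_of_ofState fun α x => (α.trans x).expect_add (φ.sem α) (ψ.sem α)

theorem eval_diamond_nonneg {φ : Formula} (h : 0 ≤ eval.{u} φ) : 0 ≤ eval.{u} (.diamond φ) :=
  closed_induction (isClosed_le continuous_const (eval (.diamond φ)).continuous) fun α x =>
    (α.trans x).expect_nonneg fun y => h (ofState α y)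

/-- Holds because the measures have mass at most one. With linearity it shows that `eval (.diamond
φ)` depends only on `eval φ`, and continuously. -/
theorem norm_eval_diamond_le (φ : Formula) : ‖eval.{u} (.diamond φ)‖ ≤ ‖eval.{u} φ‖ :=
  (ContinuousMap.norm_le _ (norm_nonneg _)).2 <|
    closed_induction (isClosed_le (eval (.diamond φ)).continuous.norm continuous_const) fun α x =>
      (α.trans x).abs_expect_le (norm_nonneg _) fun y => (eval φ).norm_coe_le_norm (ofState α y)

/-- Evaluations of formulas are dense, by the Stone-Weierstrass theorem for lattices. -/
theorem denseRange_eval : DenseRange eval.{u} := by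
  rw [DenseRange, dense_iff_closure_eq]
  refine ContinuousMap.sublattice_closure_eq_top _ ⟨_, .zero, rfl⟩ ?_ ?_ ?_
  · rintro _ ⟨φ, rfl⟩ _ ⟨ψ, rfl⟩
    exact ⟨_, eval_inf φ ψ⟩
  · rintro _ ⟨φ, rfl⟩ _ ⟨ψ, rfl⟩
    exact ⟨_, eval_sup φ ψ⟩
  · intro a v w
    by_cases hvw : v = w
    · subst hvw
      exact ⟨_, ⟨.smul (a v) .one, rfl⟩, by simp [eval_smul, eval_one]⟩
    · obtain ⟨φ, hφ⟩ : ∃ φ, eval φ v ≠ eval φ w := by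
        by_contra! h
        exact hvw (ext_eval h)
      have hne : eval φ v - eval φ w ≠ 0 := sub_ne_zero.2 hφ
      -- The affine function of `φ` that takes the prescribed values `a v` and `a w`.
      refine ⟨_, ⟨.add (.smul ((a v - a w) / (eval φ v - eval φ w)) φ)
        (.smul (a v - (a v - a w) / (eval φ v - eval φ w) * eval φ v) .one), rfl⟩, ?_, ?_⟩
      · simp [eval_add, eval_smul, eval_one]
      · simp only [eval_add, eval_smul, eval_one, ContinuousMap.add_apply,
          ContinuousMap.smul_apply, ContinuousMap.one_apply, smul_eq_mul]
        field_simp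
        ring

/-! ### Extension of the modality to all continuous functions, and its representing measures. -/

/-- Evaluation, extended linearly to formal combinations of formulas. -/
def evalLinear : (Formula →₀ ℝ) →ₗ[ℝ] C(CanonicalState.{u}, ℝ) :=
  Finsupp.linearCombination ℝ eval

/-- Evaluation under the modality, extended linearly to formal combinations of formulas. -/
def evalDiamondLinear : (Formula →₀ ℝ) →ₗ[ℝ] C(CanonicalState.{u}, ℝ) :=
  Finsupp.linearCombination ℝ fun φ => eval (.diamond φ)

/-- `Formula` is not a vector space, so the linear extension starts from formal combinations. One
formula realizes both evaluations of a combination, which carries the contraction bound over. -/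
theorem exists_eval_eq (s : Formula →₀ ℝ) :
    ∃ φ, evalLinear.{u} s = eval φ ∧ evalDiamondLinear.{u} s = eval (.diamond φ) := by
  induction s using Finsupp.induction_linear with
  | zero => exact ⟨.zero, by simp [eval_zero], by simp [eval_diamond_zero]⟩
  | add s t hs ht =>
    obtain ⟨φ, h1, h2⟩ := hs
    obtain ⟨ψ, h3, h4⟩ := ht
    exact ⟨.add φ ψ, by rw [map_add, h1, h3, eval_add], by rw [map_add, h2, h4, eval_diamond_add]⟩
  | single φ r =>
    exact ⟨.smul r φ, by simp [evalLinear, eval_smul],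
      by simp [evalDiamondLinear, eval_diamond_smul]⟩

theorem denseRange_evalLinear : DenseRange evalLinear.{u} :=
  denseRange_eval.mono <| by
    rintro _ ⟨φ, rfl⟩
    exact ⟨Finsupp.single φ 1, by simp [evalLinear]⟩

theorem norm_evalDiamondLinear_le (s : Formula →₀ ℝ) :
    ‖evalDiamondLinear.{u} s‖ ≤ 1 * ‖evalLinear.{u} s‖ := by
  obtain ⟨φ, h1, h2⟩ := exists_eval_eq s
  rw [h1, h2, one_mul]
  exact norm_eval_diamond_le φ

/-- The modality as an operator on the continuous functions on the canonical state space. -/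
def diamondOp : C(CanonicalState.{u}, ℝ) →L[ℝ] C(CanonicalState.{u}, ℝ) :=
  evalDiamondLinear.extendOfNorm evalLinear

theorem diamondOp_eval (φ : Formula) : diamondOp.{u} (eval φ) = eval (.diamond φ) := by
  have h := LinearMap.extendOfNorm_eq denseRange_evalLinear.{u} ⟨1, norm_evalDiamondLinear_le⟩
    (Finsupp.single φ 1)
  simpa only [evalLinear, evalDiamondLinear, Finsupp.linearCombination_single, one_smul] using! h

theorem diamondOp_nonneg {f : C(CanonicalState.{u}, ℝ)} (hf : 0 ≤ f) : 0 ≤ diamondOp f := by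
  -- Formulas approximating `f ≥ 0` may take negative values. Truncation by `c` fixes `f` and turns
  -- each formula `φ` into the nonnegative formula `φ ⊔ 0`.
  let c : C(ℝ, ℝ) := ⟨fun t => max t 0, by fun_prop⟩
  have hc (g : C(CanonicalState.{u}, ℝ)) : c.comp g = g ⊔ 0 := rfl
  intro v
  suffices h : ∀ g, 0 ≤ diamondOp.{u} (c.comp g) v by simpa [hc, sup_eq_left.2 hf] using h f
  intro g
  refine denseRange_eval.induction_on g ?_ fun φ => ?_
  · exact isClosed_le continuous_const ((continuous_eval_const v).comp
      (diamondOp.continuous.comp c.continuous_postcomp))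
  · rw [hc, ← eval_zero, ← eval_sup, diamondOp_eval]
    refine eval_diamond_nonneg ?_ v
    rw [eval_sup, eval_zero]
    exact le_sup_right

theorem diamondOp_one_le (v : CanonicalState.{u}) : diamondOp 1 v ≤ 1 := by
  rw [← eval_one, diamondOp_eval]
  refine (le_abs_self _).trans (((eval _).norm_coe_le_norm v).trans
    ((norm_eval_diamond_le _).trans ?_))
  rw [eval_one]
  exact (ContinuousMap.norm_le _ zero_le_one).2 fun _ => by simp

theorem exists_transition (v : CanonicalState.{u}) :
    ∃ μ : RadonSubprob CanonicalState.{u}, ∀ f, μ.expect f = diamondOp f v :=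
  RadonSubprob.exists_expect_eq
    { toFun := fun f => diamondOp f v
      map_add' := fun f g => by simp
      map_smul' := fun r f => by simp }
    (fun _ hf => diamondOp_nonneg hf v) (diamondOp_one_le v)

/-- The transition measures on the canonical state space. -/
def transition (v : CanonicalState.{u}) : RadonSubprob CanonicalState.{u} :=
  (exists_transition v).choose

theorem expect_transition (v : CanonicalState.{u}) (f : C(CanonicalState.{u}, ℝ)) :
    (transition v).expect f = diamondOp f v :=
  (exists_transition v).choose_spec f

end CanonicalState

open CanonicalState

/-! ### The canonical process, its finality and the separation of states. -/

/-- The canonical Markov process, on the canonical state space. -/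
def canonicalProcess : MarkovProcess.{u} where
  State := CanonicalState.{u}
  trans :=
    { toFun := transition
      continuous_toFun := RadonSubprob.continuous_of_continuous_expect fun f => by
        simp only [expect_transition]
        exact (diamondOp f).continuous }

/-- The truth lemma: formulas are interpreted over the canonical process by evaluation. -/
theorem sem_canonicalProcess : ∀ φ : Formula, φ.sem canonicalProcess.{u} = eval φ
  | .zero => eval_zero.symm
  | .one => eval_one.symm
  | .smul r φ => (congrArg (r • ·) (sem_canonicalProcess φ)).trans (eval_smul r φ).symm
  | .add φ ψ => (congrArg₂ (· + ·) (sem_canonicalProcess φ) (sem_canonicalProcess ψ)).trans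
      (eval_add φ ψ).symm
  | .sup φ ψ => (congrArg₂ (· ⊔ ·) (sem_canonicalProcess φ) (sem_canonicalProcess ψ)).trans
      (eval_sup φ ψ).symm
  | .inf φ ψ => (congrArg₂ (· ⊓ ·) (sem_canonicalProcess φ) (sem_canonicalProcess ψ)).trans
      (eval_inf φ ψ).symm
  | .diamond φ => by
    ext v
    change (transition v).expect (φ.sem canonicalProcess) = _
    rw [sem_canonicalProcess φ]
    exact (expect_transition v (eval φ)).trans (DFunLike.congr_fun (diamondOp_eval φ) v)

/-- Expectations are continuous in the integrand, so formulas suffice as test functions; on `φ` both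
sides give the value of `◇φ` at `x`. -/
theorem isHom_ofStateMap (α : MarkovProcess.{u}) :
    MarkovProcess.IsHom α canonicalProcess (ofStateMap α) := fun x => by
  refine RadonSubprob.ext_expect fun f => ?_
  refine denseRange_eval.induction_on f
    (isClosed_eq (RadonSubprob.continuous_expect_right _)
      (RadonSubprob.continuous_expect_right _)) fun φ => ?_
  exact (RadonSubprob.expect_map (ofStateMap α) (α.trans x) (eval φ)).trans
    ((expect_transition (ofState α x) (eval φ)).trans
      (DFunLike.congr_fun (diamondOp_eval φ) (ofState α x))).symm

theorem isFinal_canonicalProcess : canonicalProcess.{u}.IsFinal := fun β => by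
  refine ⟨ofStateMap β, isHom_ofStateMap β, fun g hg => ContinuousMap.ext fun x => ?_⟩
  refine ext_eval fun φ => ?_
  rw [← sem_canonicalProcess]
  exact (hg.sem_apply φ x).trans ((isHom_ofStateMap β).sem_apply φ x).symm

/-- The theory map of `ω` followed by a morphism back to `ω` is an endomorphism, hence the identity
by finality. So the theory map is injective. -/
theorem MarkovProcess.IsFinal.exists_sem_ne {ω : MarkovProcess.{u}} (hω : ω.IsFinal)
    {x y : ω.State} (hxy : x ≠ y) : ∃ φ : Formula, φ.sem ω x ≠ φ.sem ω y := by
  by_contra! h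
  obtain ⟨g, hg, -⟩ := hω canonicalProcess
  have hid : g.comp (ofStateMap ω) = ContinuousMap.id _ :=
    (hω ω).unique (hg.comp (isHom_ofStateMap ω)) ω.isHom_id
  have hx : ofStateMap ω x = ofStateMap ω y := ext_eval h
  exact hxy ((DFunLike.congr_fun hid x).symm.trans
    ((congrArg g hx).trans (DFunLike.congr_fun hid y)))

end RieszModal

end

theorem theorem7p2 :
    (∃ ω : RieszModal.MarkovProcess.{u}, ω.IsFinal) ∧
      ∀ ω : RieszModal.MarkovProcess.{u}, ω.IsFinal →
        ∀ x y : ω.State, x ≠ y →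
          ∃ φ : RieszModal.Formula, φ.sem ω x ≠ φ.sem ω y :=
  ⟨⟨_, RieszModal.isFinal_canonicalProcess⟩, fun _ hω _ _ hxy => hω.exists_sem_ne hxy⟩
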